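/- Let $k$ be an infinite field, let $S=k[x_1,\ldots,x_n]$ with the standard grading, and for $1\le r\le n-1$ let $S(r)=k[x_1,\ldots,x_r]$, with maximal homogeneous ideal $\mathfrak m(r)=(x_1,\ldots,x_r)$. Let $\Pi_r:S\to S(r)$ be the $k$-algebra map with $x_i\mapsto x_i$ for $i\le r$ and $x_i\mapsto 0$ for $i>r$. For a monomial $w=x_1^{e_1}\cdots x_n^{e_n}$ put $\Phi_r(w)=x_1^{e_1}\cdots x_r^{e_r}$; for a monomial ideal $J\subset S$ let $\Phi_r(J)$ be the ideal of $S$ generated by the $\Phi_r(w)$, where $w$ runs over the minimal monomial generators of $J$, and let $\overline{\Phi_r}(J)=\Pi_r(\Phi_r(J))\subset S(r)$. For an ideal $I\subset S$ let $\mathrm{in}(I)$ be the ideal generated by the initial monomials of the nonzero elements of $I$ with respect to the graded reverse lexicographic order with $x_1>\cdots>x_n$. The generic initial ideal $\mathrm{gin}(I)$ of a homogeneous ideal $I$ is the common value of $\mathrm{in}(\alpha(I))$ for all $\alpha$ in a suitable nonempty Zariski open subset of $GL_n(k)$, which acts on $S$ by linear changes of coordinates. **Theorem.** Let $P$ be a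 homogeneous prime ideal of $S$ and let $J=\mathrm{gin}(P)$. Assume that for some $1\le r\le n-1$ there is a monomial $u\in \Pi_r(J):\mathfrak m(r)$ with $u\notin\Pi_r(J)$ and $$\overline{\Phi_r}(J)=\Pi_r(J)+(u).$$ Call a monomial $v$ an extra generator of $J$ if $J$ is generated by $J\cap k[x_1,\ldots,x_r]$ and $v$, and $v$ does not lie in the ideal of $S$ generated by $J\cap k[x_1,\ldots,x_r]$. Then: 1. Either $u=1$ and $(x_1,\ldots,x_r)\subset J$, or $J$ has an extra generator $v$. 2. If $u\neq 1$, then every extra generator is of the form $v=u\,x_{r+1}^e$ for some $e>0$. 3. If $u\neq 1$, then $J$ is generated by monomials in $k[x_1,\ldots,x_{r+1}]$. -/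

import Mathlib

open MvPolynomial

attribute [local instance] MvPolynomial.gradedAlgebra

noncomputable section

theorem sum_lt_succ {n : ℕ} (a : Fin n →₀ ℕ) (i : Fin n) :
    ∑ j : Fin n with j.val < i.val + 1, a j = ∑ j : Fin n with j.val < i.val, a j + a i := by
  have : (Finset.univ.filter fun j : Fin n => j.val < i.val + 1) =
      insert i (Finset.univ.filter fun j : Fin n => j.val < i.val) := by
    ext j
    simp [Fin.ext_iff]
    omega
  rw [this, Finset.sum_insert (by simp), add_comm]

/-- The vector `(a₁ + ⋯ + aₙ, a₁ + ⋯ + aₙ₋₁, …, a₁)` attached to an exponent vector `a`. -/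
def revPartialSums (n : ℕ) : (Fin n →₀ ℕ) →+ Lex (Fin n → ℕ) where
  toFun a := toLex fun i => ∑ j : Fin n with j.val < n - i.val, a j
  map_zero' := by
    apply ofLex.injective
    funext i
    change ∑ j : Fin n with j.val < n - i.val, (0 : Fin n →₀ ℕ) j = 0
    simp
  map_add' a b := by
    apply ofLex.injective
    funext i
    change ∑ j : Fin n with j.val < n - i.val, (a + b) j =
      ∑ j : Fin n with j.val < n - i.val, a j + ∑ j : Fin n with j.val < n - i.val, b j
    simp [Finset.sum_add_distrib]

theorem revPartialSums_injective (n : ℕ) : Function.Injective (revPartialSums n) := by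
  intro a b h
  have h1 : ∀ m ≤ n, ∑ j : Fin n with j.val < m, a j = ∑ j : Fin n with j.val < m, b j := by
    intro m hm
    rcases Nat.eq_zero_or_pos m with rfl | hm0
    · simp
    have h2 : ∑ j : Fin n with j.val < n - (n - m), a j =
        ∑ j : Fin n with j.val < n - (n - m), b j :=
      congrFun (congrArg ofLex h) ⟨n - m, by omega⟩
    rwa [Nat.sub_sub_self hm] at h2
  ext i
  have h2 := h1 (i.val + 1) i.isLt
  rw [sum_lt_succ, sum_lt_succ, h1 i.val i.isLt.le] at h2
  exact Nat.add_left_cancel h2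

/-- The graded reverse lexicographic order on the monomials in `n` variables, with
`x₁ > x₂ > ⋯ > xₙ`, obtained by comparing `(a₁ + ⋯ + aₙ, a₁ + ⋯ + aₙ₋₁, …, a₁)`
lexicographically; see `degRevLex_lt_iff` for the usual description. -/
def degRevLex (n : ℕ) : MonomialOrder (Fin n) where
  syn := AddMonoidHom.mrange (revPartialSums n)
  addCommMonoidSyn := inferInstance
  linearOrderSyn := inferInstance
  isOrderedAddMonoid_syn := inferInstance
  wellFoundedLT_syn := inferInstance
  toSyn := AddEquiv.ofBijective (revPartialSums n).mrangeRestrict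
    ⟨fun _ _ h => revPartialSums_injective n (congrArg Subtype.val h),
      (revPartialSums n).mrangeRestrict_surjective⟩
  toSyn_monotone := by
    intro a b h
    change revPartialSums n a ≤ revPartialSums n b
    apply Pi.toLex_monotone
    intro i
    exact Finset.sum_le_sum fun j _ => h j

open scoped MonomialOrder in
/-- `x^a < x^b` iff `deg a < deg b`, or the degrees agree and at the last index where the exponents
differ `a` has the larger one. -/
theorem degRevLex_lt_iff {n : ℕ} (a b : Fin n →₀ ℕ) :
    a ≺[degRevLex n] b ↔ a.degree < b.degree ∨
      (a.degree = b.degree ∧ ∃ i, b i < a i ∧ ∀ j, i < j → a j = b j) := by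
  have hdeg : ∀ c : Fin n →₀ ℕ, ∑ j : Fin n with j.val < n, c j = c.degree := by
    intro c
    simp [Finsupp.degree_eq_sum]
  have key : a ≺[degRevLex n] b ↔ ∃ i : Fin n,
      (∀ j : Fin n, j < i → ∑ l : Fin n with l.val < n - j.val, a l =
        ∑ l : Fin n with l.val < n - j.val, b l) ∧
      ∑ l : Fin n with l.val < n - i.val, a l < ∑ l : Fin n with l.val < n - i.val, b l := Iff.rfl
  rw [key]
  constructor
  · rintro ⟨i, hi, hlt⟩
    rcases Nat.eq_zero_or_pos i.val with h0 | h0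
    · left
      rw [h0, Nat.sub_zero, hdeg, hdeg] at hlt
      exact hlt
    · right
      have hi' : ∀ m, n - i.val < m → m ≤ n → ∑ l : Fin n with l.val < m, a l =
          ∑ l : Fin n with l.val < m, b l := by
        intro m h1 h2
        have := hi ⟨n - m, by omega⟩ (by rw [Fin.lt_def]; simp only; omega)
        simpa only [Nat.sub_sub_self h2] using this
      refine ⟨?_, ⟨n - i.val, by omega⟩, ?_, ?_⟩
      · rw [← hdeg, ← hdeg]
        exact hi' n (by omega) le_rfl
      · have h2 := hi' (n - i.val + 1) (by omega) (by omega)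
        have ha := sum_lt_succ a ⟨n - i.val, by omega⟩
        have hb := sum_lt_succ b ⟨n - i.val, by omega⟩
        simp only at ha hb
        omega
      · intro j hj
        rw [Fin.lt_def] at hj
        simp only at hj
        have h2 := hi' (j.val + 1) (by omega) (by omega)
        have h3 := hi' j.val (by omega) (by omega)
        rw [sum_lt_succ, sum_lt_succ] at h2
        omega
  · rintro (h | ⟨hd, i, hi, hj⟩)
    · have hn : 0 < n := by
        rcases Nat.eq_zero_or_pos n with rfl | h0
        · simp [Subsingleton.elim a b] at h
        · exact h0
      refine ⟨⟨0, hn⟩, fun j hj => absurd hj (by simp [Fin.lt_def]), ?_⟩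
      simp only [Nat.sub_zero]
      rw [hdeg, hdeg]
      exact h
    · have hs : ∀ t m, m + t = n → i.val < m → ∑ l : Fin n with l.val < m, a l =
          ∑ l : Fin n with l.val < m, b l := by
        intro t
        induction t with
        | zero =>
          intro m hm _
          obtain rfl : m = n := by omega
          rw [hdeg, hdeg, hd]
        | succ t ih =>
          intro m hm him
          have h2 := ih (m + 1) (by omega) (by omega)
          have ha := sum_lt_succ a ⟨m, by omega⟩
          have hb := sum_lt_succ b ⟨m, by omega⟩
          have hm' := hj ⟨m, by omega⟩ (by rw [Fin.lt_def]; exact him)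
          simp only at ha hb
          omega
      have h1 := hs (n - (i.val + 1)) (i.val + 1) (by omega) (by omega)
      rw [sum_lt_succ, sum_lt_succ] at h1
      have hi0 : 0 < i.val := by
        rcases Nat.eq_zero_or_pos i.val with h0 | h0
        · rw [h0] at h1
          simp at h1
          omega
        · exact h0
      refine ⟨⟨n - i.val, by omega⟩, ?_, ?_⟩
      · intro j hj'
        rw [Fin.lt_def] at hj'
        simp only at hj'
        exact hs j.val (n - j.val) (by omega) (by omega)
      · simp only [Nat.sub_sub_self i.isLt.le]
        omega

/-- The initial ideal of `I`: generated by the leading monomials of the nonzero elements of `I`. -/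
def initialIdeal {k : Type*} [Field k] {n : ℕ} (m : MonomialOrder (Fin n))
    (I : Ideal (MvPolynomial (Fin n) k)) : Ideal (MvPolynomial (Fin n) k) :=
  Ideal.span {g | ∃ f ∈ I, f ≠ 0 ∧ g = monomial (m.degree f) 1}

/-- The linear change of coordinates `x_j ↦ ∑ i, α i j * x_i` given by a matrix `α ∈ GLₙ(k)`. -/
def linearSubst {k : Type*} [Field k] {n : ℕ} (α : GL (Fin n) k) :
    MvPolynomial (Fin n) k →ₐ[k] MvPolynomial (Fin n) k :=
  aeval fun j => ∑ i, C (α.val i j) * X i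

/-- Zariski open subsets of `GLₙ(k)`, as a subspace of the affine space of `n × n` matrices. -/
def IsZariskiOpen {k : Type*} [Field k] {n : ℕ} (U : Set (GL (Fin n) k)) : Prop :=
  ∃ F : Set (MvPolynomial (Fin n × Fin n) k),
    U = {α | ∃ f ∈ F, eval (fun p => α.val p.1 p.2) f ≠ 0}

/-- Over an infinite field, two nonempty Zariski open subsets of `GLₙ(k)` meet. -/
theorem IsZariskiOpen.inter_nonempty {k : Type*} [Field k] [Infinite k] {n : ℕ}
    {U V : Set (GL (Fin n) k)} (hU : IsZariskiOpen U) (hV : IsZariskiOpen V)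
    (hU' : U.Nonempty) (hV' : V.Nonempty) : (U ∩ V).Nonempty := by
  obtain ⟨F, rfl⟩ := hU
  obtain ⟨G, rfl⟩ := hV
  obtain ⟨α, f, hf, hα⟩ := hU'
  obtain ⟨β, g, hg, hβ⟩ := hV'
  let d : MvPolynomial (Fin n × Fin n) k := (Matrix.of fun i j => X (i, j)).det
  have hd : ∀ M : Matrix (Fin n) (Fin n) k, eval (fun p => M p.1 p.2) d = M.det := by
    intro M
    rw [RingHom.map_det]
    congr 1
    ext i j
    simp
  have hne : f * g * d ≠ 0 := by
    refine mul_ne_zero (mul_ne_zero ?_ ?_) ?_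
    · rintro rfl
      simp at hα
    · rintro rfl
      simp at hβ
    · intro h0
      have := hd 1
      rw [h0] at this
      simp at this
  obtain ⟨x, hx⟩ : ∃ x, eval x (f * g * d) ≠ 0 := by
    by_contra! h
    exact hne (MvPolynomial.funext fun x => by simpa using h x)
  let M : Matrix (Fin n) (Fin n) k := Matrix.of fun i j => x (i, j)
  have hM : eval (fun p => M p.1 p.2) (f * g * d) ≠ 0 := hx
  simp only [map_mul, hd] at hM
  have hM' := mul_ne_zero_iff.1 hM
  have hM'' := mul_ne_zero_iff.1 hM'.1
  exact ⟨Matrix.GeneralLinearGroup.mkOfDetNeZero M hM'.2, ⟨f, hf, hM''.1⟩, ⟨g, hg, hM''.2⟩⟩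

/-- `J` is the generic initial ideal of `I` for the graded reverse lexicographic order: the
common value of `in(α(I))` for all `α` in a nonempty Zariski open subset of `GLₙ(k)`. -/
def IsGenericInitialIdeal {k : Type*} [Field k] {n : ℕ}
    (I J : Ideal (MvPolynomial (Fin n) k)) : Prop :=
  ∃ U : Set (GL (Fin n) k), IsZariskiOpen U ∧ U.Nonempty ∧
    ∀ α ∈ U, initialIdeal (degRevLex n) (I.map (linearSubst α)) = J

/-- Over an infinite field there is at most one generic initial ideal. -/
theorem IsGenericInitialIdeal.unique {k : Type*} [Field k] [Infinite k] {n : ℕ}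
    {I J J' : Ideal (MvPolynomial (Fin n) k)}
    (h : IsGenericInitialIdeal I J) (h' : IsGenericInitialIdeal I J') : J = J' := by
  obtain ⟨U, hU, hU0, hUJ⟩ := h
  obtain ⟨V, hV, hV0, hVJ⟩ := h'
  obtain ⟨α, hαU, hαV⟩ := hU.inter_nonempty hV hU0 hV0
  rw [← hUJ α hαU, hVJ α hαV]

/-- The exponents of the minimal monomial generators of a monomial ideal: the monomials in `J`
that are minimal for divisibility. -/
def minimalMonomials {k : Type*} [Field k] {n : ℕ} (J : Ideal (MvPolynomial (Fin n) k)) :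
    Set (Fin n →₀ ℕ) :=
  {a | Minimal (fun b => monomial b (1 : k) ∈ J) a}

/-- The projection `Π_r : k[x₁,…,xₙ] → k[x₁,…,x_r]` killing `x_{r+1},…,xₙ`. -/
def projVars (k : Type*) [Field k] (n r : ℕ) :
    MvPolynomial (Fin n) k →ₐ[k] MvPolynomial (Fin r) k :=
  aeval fun i => if h : i.val < r then X ⟨i.val, h⟩ else 0

/-- `Φ_r(J)` for a monomial ideal `J`: generated by the monomials `Φ_r(u)`, obtained by deleting
all factors `x_{r+1},…,xₙ` from the minimal monomial generators `u` of `J`. -/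
def Phi {k : Type*} [Field k] {n : ℕ} (r : ℕ) (J : Ideal (MvPolynomial (Fin n) k)) :
    Ideal (MvPolynomial (Fin n) k) :=
  Ideal.span ((fun a => monomial (a.filter fun i => i.val < r) 1) '' minimalMonomials J)

/-- The ideal `Π_r(Φ_r(J))` of `k[x₁,…,x_r]`. -/
def PhiBar {k : Type*} [Field k] {n : ℕ} (r : ℕ) (J : Ideal (MvPolynomial (Fin n) k)) :
    Ideal (MvPolynomial (Fin r) k) :=
  (Phi r J).map (projVars k n r)

/-- The maximal homogeneous ideal `(x₁,…,x_r)` of `k[x₁,…,x_r]`. -/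
def maxHomogeneousIdeal (k : Type*) [Field k] (r : ℕ) : Ideal (MvPolynomial (Fin r) k) :=
  Ideal.span (Set.range X)

/-- The ideal of `k[x₁,…,xₙ]` generated by `J ∩ k[x₁,…,x_r]`. -/
def contractExtend {k : Type*} [Field k] {n : ℕ} (r : ℕ) (J : Ideal (MvPolynomial (Fin n) k)) :
    Ideal (MvPolynomial (Fin n) k) :=
  Ideal.span {f | f ∈ J ∧ f ∈ supported k {i : Fin n | i.val < r}}

/-- The monomial `x^b` is the one extra generator of `J` over `J ∩ k[x₁,…,x_r]`: together they
generate `J`, and `J ∩ k[x₁,…,x_r]` alone does not generate `x^b`. -/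
def IsExtraGenerator {k : Type*} [Field k] {n : ℕ} (r : ℕ) (J : Ideal (MvPolynomial (Fin n) k))
    (b : Fin n →₀ ℕ) : Prop :=
  J = contractExtend r J ⊔ Ideal.span {monomial b 1} ∧ monomial b 1 ∉ contractExtend r J

end

/-
Let `x^s = u` with `s ≠ 0`, and let `Q = α(P)` in generic coordinates, so that `in(Q) = J`. Then
`Q ∩ k[x_{r+1},…,xₙ] = 0`, so by primality `Q` is saturated with respect to the nonzero polynomials
in `x_{r+1},…,xₙ`. Write `f ∈ Q` as `∑ x^t f_t` with `t` running over exponents in `x₁,…,x_r` and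
`f_t ∈ k[x_{r+1},…,xₙ]`, and suppose that `f_t = 0` whenever `x^t ∈ J`. If `f ≠ 0`, then its leading
monomial is `x^s in(f_s)`; hence `f_s` determines `f`, and any two such elements satisfy
`f_s f' = f'_s f`. Choosing `f` with `f_s` minimal for divisibility makes `f_s` and `f` coprime by
saturation, so `f_s` divides every `f'_s`, and `x^s in(f_s)` divides every monomial of `J` that does
not come from `J ∩ k[x₁,…,x_r]`.

A generic substitution in `x_{r+1},…,xₙ` that changes neither `J` nor `x₁,…,x_r` turns `in(f_s)`
into a power of `x_{r+1}`. Then `x^s x_{r+1}^e ∈ J` for some `e`, so `in(f_s)` divides `x_{r+1}^e`.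
-/

section Filter

variable {σ : Type*} {p : σ → Prop} [DecidablePred p]

theorem finsupp_filter_le (p : σ → Prop) [DecidablePred p] (c : σ →₀ ℕ) : c.filter p ≤ c := by
  intro i
  rw [Finsupp.filter_apply]
  split_ifs
  exacts [le_rfl, zero_le]

theorem finsupp_filter_mono {c d : σ →₀ ℕ} (h : c ≤ d) : c.filter p ≤ d.filter p := by
  intro i
  rw [Finsupp.filter_apply, Finsupp.filter_apply]
  split_ifs
  exacts [h i, le_rfl]

theorem finsupp_filter_filter_self (p : σ → Prop) [DecidablePred p] (c : σ →₀ ℕ) :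
    (c.filter p).filter p = c.filter p :=
  Finsupp.filter_eq_self_iff _ _ |>.2 fun i hi => by
    by_contra h
    exact hi (Finsupp.filter_apply_neg p c h)

theorem finsupp_filter_add_of_filter_eq_zero {c d : σ →₀ ℕ} (hd : d.filter p = 0) :
    (c + d).filter p = c.filter p := by
  rw [Finsupp.filter_add, hd, add_zero]

end Filter

section FilterSupported

variable {σ R : Type*} [CommSemiring R] {p : σ → Prop}

theorem mem_supported_setOf_not_iff [DecidablePred p] {f : MvPolynomial σ R} :
    f ∈ supported R {i | ¬ p i} ↔ ∀ c ∈ f.support, c.filter p = 0 := by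
  simp only [mem_supported, Set.subset_def, Finset.mem_coe, mem_vars_iff_mem_support,
    Finsupp.filter_eq_zero_iff, Set.mem_ofPred_eq, Finsupp.mem_support_iff]
  exact ⟨fun h c hc i hi => by_contra fun hci => h i ⟨c, hc, hci⟩ hi,
    fun h i ⟨c, hc, hci⟩ hi => hci (h c hc i hi)⟩

/-- The polynomials all of whose monomials have their part in the variables satisfying `p` in `T`.
They form a module over the polynomial ring `supported R {i | ¬ p i}` in the other variables. -/
noncomputable def filterSupported (R : Type*) [CommSemiring R] (p : σ → Prop) [DecidablePred p]
    (T : Set (σ →₀ ℕ)) : Submodule R (MvPolynomial σ R) :=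
  restrictSupport R {c | c.filter p ∈ T}

variable [DecidablePred p] {T : Set (σ →₀ ℕ)}

theorem mem_filterSupported {f : MvPolynomial σ R} :
    f ∈ filterSupported R p T ↔ ∀ c ∈ f.support, c.filter p ∈ T :=
  Iff.rfl

theorem mul_mem_filterSupported {d f : MvPolynomial σ R}
    (hd : d ∈ supported R {i | ¬ p i}) (hf : f ∈ filterSupported R p T) :
    d * f ∈ filterSupported R p T := by
  classical
  refine mem_filterSupported.2 fun c hc => ?_
  obtain ⟨a, ha, b, hb, rfl⟩ := Finset.mem_add.1 (support_mul d f hc)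
  rw [add_comm, finsupp_filter_add_of_filter_eq_zero (mem_supported_setOf_not_iff.1 hd a ha)]
  exact hf hb

theorem exists_filterSupported_add_compl (p : σ → Prop) [DecidablePred p]
    (T : Set (σ →₀ ℕ)) (f : MvPolynomial σ R) :
    ∃ g ∈ filterSupported R p T, ∃ h ∈ filterSupported R p Tᶜ, g + h = f := by
  classical
  refine ⟨∑ c ∈ f.support with c.filter p ∈ T, monomial c (coeff c f), ?_,
    ∑ c ∈ f.support with c.filter p ∉ T, monomial c (coeff c f), ?_,
    (Finset.sum_filter_add_sum_filter_not _ _ _).trans f.support_sum_monomial_coeff⟩ <;>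
  exact Submodule.sum_mem _ fun c hc =>
    (monomial_mem_restrictSupport R).2 (.inl (Finset.mem_filter.1 hc).2)

theorem eq_zero_of_mem_filterSupported_compl {f : MvPolynomial σ R}
    (hf : f ∈ filterSupported R p T) (hf' : f ∈ filterSupported R p Tᶜ) : f = 0 :=
  support_eq_empty.1 (Finset.eq_empty_of_forall_notMem fun _ hc => hf' hc (hf hc))

theorem mem_filterSupported_of_mul_mem {A : Type*} [CommRing A] [IsDomain A]
    {d f : MvPolynomial σ A} (hd0 : d ≠ 0) (hd : d ∈ supported A {i | ¬ p i})
    (hf : d * f ∈ filterSupported A p T) : f ∈ filterSupported A p T := by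
  obtain ⟨g, hg, h, hh, rfl⟩ := exists_filterSupported_add_compl p T f
  have hdh : d * h ∈ filterSupported A p T := by
    simpa only [mul_add, add_sub_cancel_left] using sub_mem hf (mul_mem_filterSupported hd hg)
  have hdh0 := eq_zero_of_mem_filterSupported_compl hdh (mul_mem_filterSupported hd hh)
  rwa [(mul_eq_zero.1 hdh0).resolve_left hd0, add_zero]

theorem mem_supported_of_dvd [NoZeroDivisors R] {s : Set σ} {d g : MvPolynomial σ R}
    (hg0 : g ≠ 0) (hg : g ∈ supported R s) (hdg : d ∣ g) : d ∈ supported R s := by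
  obtain ⟨q, rfl⟩ := hdg
  refine mem_supported.2 fun i hi => mem_supported.1 hg ?_
  rw [Finset.mem_coe, mem_vars_iff_degreeOf_ne_zero] at hi ⊢
  rw [degreeOf_mul_eq (left_ne_zero_of_mul hg0) (right_ne_zero_of_mul hg0)]
  omega

theorem modMonomial_mem_filterSupported (s : σ →₀ ℕ) (f : MvPolynomial σ R) :
    f.modMonomial s ∈ filterSupported R p {w | ¬ s ≤ w} :=
  mem_filterSupported.2 fun c hc hsc =>
    mem_support_iff.1 hc (coeff_modMonomial_of_le f (hsc.trans (finsupp_filter_le p c)))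

theorem divMonomial_monomial_mul_add {s : σ →₀ ℕ} (hs : s.filter p = s) {q h : MvPolynomial σ R}
    (hh : h ∈ filterSupported R p {w | ¬ s ≤ w}) :
    (monomial s 1 * q + h).divMonomial s = q := by
  have hzero : h.divMonomial s = 0 := by
    ext c
    rw [coeff_divMonomial, coeff_zero]
    by_contra hc
    refine hh (mem_support_iff.2 hc) ?_
    rw [Finsupp.filter_add, hs]
    exact le_self_add
  rw [add_divMonomial, divMonomial_monomial_mul, hzero, add_zero]

theorem mul_divMonomial_of_mem_supported {s : σ →₀ ℕ} (hs : s.filter p = s)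
    {d : MvPolynomial σ R} (hd : d ∈ supported R {i | ¬ p i}) (f : MvPolynomial σ R) :
    (d * f).divMonomial s = d * f.divMonomial s := by
  conv_lhs => rw [← divMonomial_add_modMonomial f s, mul_add, mul_left_comm]
  exact divMonomial_monomial_mul_add hs
    (mul_mem_filterSupported hd (modMonomial_mem_filterSupported s f))

section AlgHom

variable {φ : MvPolynomial σ R →ₐ[R] MvPolynomial σ R}

theorem map_monomial_of_filter_eq_self (hφ : ∀ i, p i → φ (X i) = X i) {s : σ →₀ ℕ}
    (hs : s.filter p = s) (a : R) : φ (monomial s a) = monomial s a := by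
  rw [monomial_eq, map_mul, algHom_C, algebraMap_eq, Finsupp.prod, map_prod]
  congr 1
  refine Finset.prod_congr rfl fun i hi => ?_
  rw [map_pow, hφ i ((Finsupp.filter_eq_self_iff p s).1 hs i (Finsupp.mem_support_iff.1 hi))]

theorem map_mem_supported {s t : Set σ} (hφ : ∀ i ∈ s, φ (X i) ∈ supported R t)
    {f : MvPolynomial σ R} (hf : f ∈ supported R s) : φ f ∈ supported R t := by
  suffices h : supported R s ≤ (supported R t).comap φ from h hf
  rw [supported_eq_adjoin_X, Algebra.adjoin_le_iff]
  rintro _ ⟨i, hi, rfl⟩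
  exact hφ i hi

theorem map_mem_filterSupported (hφ : ∀ i, p i → φ (X i) = X i)
    (hφ' : ∀ i, ¬ p i → φ (X i) ∈ supported R {i | ¬ p i}) {f : MvPolynomial σ R}
    (hf : f ∈ filterSupported R p T) : φ f ∈ filterSupported R p T := by
  rw [← f.support_sum_monomial_coeff, map_sum]
  refine Submodule.sum_mem _ fun c hc => ?_
  have hsplit : monomial c (coeff c f) =
      monomial (c.filter fun i => ¬ p i) 1 * monomial (c.filter p) (coeff c f) := by
    rw [monomial_mul, one_mul, add_comm, Finsupp.filter_add_filter_not]
  rw [hsplit, map_mul, map_monomial_of_filter_eq_self hφ (finsupp_filter_filter_self p c)]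
  have hmem : monomial (c.filter fun i => ¬ p i) (1 : R) ∈ supported R {i | ¬ p i} := by
    refine mem_supported_setOf_not_iff.2 fun b hb => ?_
    rw [Finset.mem_singleton.1 (support_monomial_subset hb), Finsupp.filter_eq_zero_iff]
    exact fun i hi => Finsupp.filter_apply_neg _ _ (not_not.2 hi)
  refine mul_mem_filterSupported (map_mem_supported hφ' hmem)
    ((monomial_mem_restrictSupport R).2 (.inl ?_))
  rw [Set.mem_ofPred_eq, finsupp_filter_filter_self]
  exact hf hc

theorem map_divMonomial (hφ : ∀ i, p i → φ (X i) = X i)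
    (hφ' : ∀ i, ¬ p i → φ (X i) ∈ supported R {i | ¬ p i}) {s : σ →₀ ℕ} (hs : s.filter p = s)
    (f : MvPolynomial σ R) : (φ f).divMonomial s = φ (f.divMonomial s) := by
  conv_lhs => rw [← divMonomial_add_modMonomial f s, map_add, map_mul,
    map_monomial_of_filter_eq_self hφ hs]
  exact divMonomial_monomial_mul_add hs
    (map_mem_filterSupported hφ hφ' (modMonomial_mem_filterSupported s f))

end AlgHom

end FilterSupported

section MonomialIdeal

variable {σ R : Type*} [CommSemiring R] {I J : Ideal (MvPolynomial σ R)}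

/-- The exponents of the monomials in an ideal. -/
def exponents (I : Ideal (MvPolynomial σ R)) : Set (σ →₀ ℕ) := {c | monomial c 1 ∈ I}

theorem mem_exponents {c : σ →₀ ℕ} : c ∈ exponents I ↔ monomial c 1 ∈ I := Iff.rfl

theorem isUpperSet_exponents (I : Ideal (MvPolynomial σ R)) : IsUpperSet (exponents I) := by
  intro c d hcd hc
  rw [mem_exponents, ← tsub_add_cancel_of_le hcd, ← mul_one (1 : R), ← monomial_mul]
  exact I.mul_mem_left _ hc

theorem mem_exponents_span_iff [Nontrivial R] {T : Set (σ →₀ ℕ)} {c : σ →₀ ℕ} :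
    c ∈ exponents (Ideal.span ((fun t => monomial t (1 : R)) '' T)) ↔ ∃ t ∈ T, t ≤ c := by
  classical
  rw [mem_exponents, mem_ideal_span_monomial_image, support_monomial, if_neg one_ne_zero]
  simp only [Finset.mem_singleton, forall_eq]

theorem mem_exponents_span_singleton_iff [Nontrivial R] {b c : σ →₀ ℕ} :
    c ∈ exponents (Ideal.span {monomial b (1 : R)}) ↔ b ≤ c := by
  rw [← Set.image_singleton (f := fun t => monomial t (1 : R)), mem_exponents_span_iff]
  simp only [Set.mem_singleton_iff, exists_eq_left]

/-- A monomial ideal is one that contains every monomial occurring in one of its elements. -/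
def IsMonomialIdeal (I : Ideal (MvPolynomial σ R)) : Prop :=
  ∀ f ∈ I, ∀ c ∈ f.support, c ∈ exponents I

theorem isMonomialIdeal_span (T : Set (σ →₀ ℕ)) :
    IsMonomialIdeal (Ideal.span ((fun t => monomial t (1 : R)) '' T)) := by
  intro f hf c hc
  obtain ⟨t, ht, htc⟩ := mem_ideal_span_monomial_image.1 hf c hc
  exact isUpperSet_exponents _ htc (Ideal.subset_span ⟨t, ht, rfl⟩)

theorem isMonomialIdeal_span_singleton (b : σ →₀ ℕ) :
    IsMonomialIdeal (Ideal.span {monomial b (1 : R)}) := by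
  simpa only [Set.image_singleton] using isMonomialIdeal_span (R := R) {b}

namespace IsMonomialIdeal

theorem eq_span_of_forall_exists_le (hI : IsMonomialIdeal I) {B : Set (σ →₀ ℕ)}
    (hB : B ⊆ exponents I) (hle : ∀ c ∈ exponents I, ∃ b ∈ B, b ≤ c) :
    I = Ideal.span ((fun b => monomial b 1) '' B) := by
  refine le_antisymm (fun f hf => ?_) (Ideal.span_le.2 ?_)
  · exact mem_ideal_span_monomial_image.2 fun c hc => hle c (hI f hf c hc)
  · rintro _ ⟨b, hb, rfl⟩
    exact hB hb

theorem eq_span (hI : IsMonomialIdeal I) :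
    I = Ideal.span ((fun c => monomial c 1) '' exponents I) :=
  hI.eq_span_of_forall_exists_le subset_rfl fun c hc => ⟨c, hc, le_rfl⟩

theorem eq_of_exponents_eq (hI : IsMonomialIdeal I) (hJ : IsMonomialIdeal J)
    (h : exponents I = exponents J) : I = J := by
  rw [hI.eq_span, h, ← hJ.eq_span]

theorem sup (hI : IsMonomialIdeal I) (hJ : IsMonomialIdeal J) : IsMonomialIdeal (I ⊔ J) := by
  classical
  intro f hf c hc
  obtain ⟨g, hg, h, hh, rfl⟩ := Submodule.mem_sup.1 hf
  rcases Finset.mem_union.1 (support_add hc) with hc | hc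
  · exact Ideal.mem_sup_left (hI g hg c hc)
  · exact Ideal.mem_sup_right (hJ h hh c hc)

theorem mem_exponents_sup_iff [Nontrivial R] (hI : IsMonomialIdeal I) (hJ : IsMonomialIdeal J)
    {c : σ →₀ ℕ} : c ∈ exponents (I ⊔ J) ↔ c ∈ exponents I ∨ c ∈ exponents J := by
  classical
  refine ⟨fun hc => ?_, fun hc => hc.elim Ideal.mem_sup_left Ideal.mem_sup_right⟩
  obtain ⟨g, hg, h, hh, hgh⟩ := Submodule.mem_sup.1 hc
  have hcsupp : c ∈ (g + h).support := by simp [hgh]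
  exact (Finset.mem_union.1 (support_add hcsupp)).imp (hI g hg c) (hJ h hh c)

theorem mem_map_killCompl_iff {τ : Type*} {f : σ → τ} (hf : Function.Injective f)
    {I : Ideal (MvPolynomial τ R)} (hI : IsMonomialIdeal I) {g : MvPolynomial σ R} :
    g ∈ I.map (killCompl hf) ↔ rename f g ∈ I := by
  refine ⟨fun hg => ?_, fun hg => killCompl_rename_app hf g ▸ Ideal.mem_map_of_mem _ hg⟩
  suffices h : I.map (killCompl hf) ≤ I.comap (rename f) from h hg
  rw [Ideal.map_le_iff_le_comap, hI.eq_span, Ideal.span_le]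
  rintro _ ⟨c, hc, rfl⟩
  simp only [SetLike.mem_coe, Ideal.mem_comap]
  by_cases hcf : ↑c.support ⊆ Set.range f
  · rw [killCompl_monomial_eq_monomial_comapDomain_of_subset hf 1 hcf, rename_monomial,
      Finsupp.mapDomain_comapDomain f hf c hcf]
    exact Ideal.subset_span ⟨c, hc, rfl⟩
  · rw [killCompl_monomial_eq_zero_of_not_subset hf 1 hcf, map_zero]
    exact zero_mem _

theorem map_killCompl {τ : Type*} {f : σ → τ} (hf : Function.Injective f)
    {I : Ideal (MvPolynomial τ R)} (hI : IsMonomialIdeal I) :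
    IsMonomialIdeal (I.map (killCompl hf)) := by
  classical
  intro g hg c hc
  rw [mem_exponents, hI.mem_map_killCompl_iff hf, rename_monomial]
  refine hI _ ((hI.mem_map_killCompl_iff hf).1 hg) _ ?_
  rw [support_rename_of_injective hf]
  exact Finset.mem_image_of_mem _ hc

theorem mem_exponents_map_killCompl_iff {τ : Type*} {f : σ → τ} (hf : Function.Injective f)
    {I : Ideal (MvPolynomial τ R)} (hI : IsMonomialIdeal I) {c : σ →₀ ℕ} :
    c ∈ exponents (I.map (killCompl hf)) ↔ c.mapDomain f ∈ exponents I := by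
  rw [mem_exponents, hI.mem_map_killCompl_iff hf, rename_monomial, mem_exponents]

end IsMonomialIdeal

end MonomialIdeal

section ContractExtend

variable {k : Type*} [Field k] {n r : ℕ} {J : Ideal (MvPolynomial (Fin n) k)}

theorem contractExtend_eq_span (hJ : IsMonomialIdeal J) :
    contractExtend r J = Ideal.span ((fun c => monomial c 1) ''
      {c | c ∈ exponents J ∧ (c.filter fun i => i.val < r) = c}) := by
  refine le_antisymm (Ideal.span_le.2 ?_) (Ideal.span_mono ?_)
  · rintro f ⟨hfJ, hf⟩
    refine mem_ideal_span_monomial_image.2 fun c hc => ⟨c, ⟨hJ f hfJ c hc, ?_⟩, le_rfl⟩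
    exact (Finsupp.filter_eq_self_iff _ _).2 fun i hi =>
      mem_supported.1 hf ((mem_vars_iff_mem_support i).2 ⟨c, hc, Finsupp.mem_support_iff.2 hi⟩)
  · rintro _ ⟨c, ⟨hc, hcr⟩, rfl⟩
    refine ⟨hc, mem_supported.2 ?_⟩
    rw [vars_monomial one_ne_zero]
    exact fun i hi => (Finsupp.filter_eq_self_iff _ _).1 hcr i (Finsupp.mem_support_iff.1 hi)

theorem mem_exponents_contractExtend_iff (hJ : IsMonomialIdeal J) {c : Fin n →₀ ℕ} :
    c ∈ exponents (contractExtend r J) ↔ (c.filter fun i => i.val < r) ∈ exponents J := by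
  rw [contractExtend_eq_span hJ, mem_exponents_span_iff]
  constructor
  · rintro ⟨t, ⟨ht, htr⟩, htc⟩
    exact isUpperSet_exponents J (htr ▸ finsupp_filter_mono htc) ht
  · exact fun h => ⟨_, ⟨h, finsupp_filter_filter_self _ c⟩, finsupp_filter_le _ c⟩

theorem isExtraGenerator_iff (hJ : IsMonomialIdeal J) {b : Fin n →₀ ℕ} :
    IsExtraGenerator r J b ↔
      IsLeast {c | c ∈ exponents J ∧ (c.filter fun i => i.val < r) ∉ exponents J} b := by
  have hC : IsMonomialIdeal (contractExtend r J) :=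
    contractExtend_eq_span hJ ▸ isMonomialIdeal_span _
  have hb := isMonomialIdeal_span_singleton (R := k) b
  have hsup : ∀ c, c ∈ exponents (contractExtend r J ⊔ Ideal.span {monomial b 1}) ↔
      (c.filter fun i => i.val < r) ∈ exponents J ∨ b ≤ c := fun c => by
    rw [hC.mem_exponents_sup_iff hb, mem_exponents_contractExtend_iff hJ,
      mem_exponents_span_singleton_iff]
  rw [IsExtraGenerator, ← mem_exponents, mem_exponents_contractExtend_iff hJ]
  constructor
  · rintro ⟨hgen, hbr⟩
    refine ⟨⟨?_, hbr⟩, fun c ⟨hc, hcr⟩ => ?_⟩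
    · rw [hgen]
      exact (hsup b).2 (.inr le_rfl)
    · rw [hgen] at hc
      exact ((hsup c).1 hc).resolve_left hcr
  · rintro ⟨⟨hbJ, hbr⟩, hleast⟩
    refine ⟨hJ.eq_of_exponents_eq (hC.sup hb) (Set.ext fun c => ?_), hbr⟩
    rw [hsup]
    refine ⟨fun hc => or_iff_not_imp_left.2 fun hcr => hleast ⟨hc, hcr⟩, ?_⟩
    rintro (hcr | hbc)
    · exact isUpperSet_exponents J (finsupp_filter_le _ c) hcr
    · exact isUpperSet_exponents J hbc hbJ

theorem exists_eq_span_of_isLeast (hJ : IsMonomialIdeal J) {b : Fin n →₀ ℕ}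
    (hb : ∀ j : Fin n, r < j.val → b j = 0)
    (hleast : IsLeast {c | c ∈ exponents J ∧ (c.filter fun i => i.val < r) ∉ exponents J} b) :
    ∃ B : Set (Fin n →₀ ℕ), (∀ b ∈ B, ∀ j : Fin n, r < j.val → b j = 0) ∧
      J = Ideal.span ((fun b => monomial b 1) '' B) := by
  refine ⟨{c | c ∈ exponents J ∧ ∀ j : Fin n, r < j.val → c j = 0}, fun _ hc => hc.2,
    hJ.eq_span_of_forall_exists_le (fun _ hc => hc.1) fun c hc => ?_⟩
  by_cases hcr : (c.filter fun i => i.val < r) ∈ exponents J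
  · exact ⟨_, ⟨hcr, fun j hj => Finsupp.filter_apply_neg _ c hj.not_gt⟩, finsupp_filter_le _ c⟩
  · exact ⟨b, ⟨hleast.1.1, hb⟩, hleast.2 ⟨hc, hcr⟩⟩

end ContractExtend

section SocleShape

variable {σ : Type*} {p : σ → Prop} [DecidablePred p] {M : Set (σ →₀ ℕ)} {s : σ →₀ ℕ}

/-- The shape of the set `M` of exponents of a monomial ideal `J` whose image under `Φ` is
`Π(J) + (x^s)`, where `Π` kills the variables not satisfying `p` and `Φ` sets them to `1`: `x^s` is
a monomial in the variables satisfying `p`, it lies in the socle of the quotient by `Π(J)`, and it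
is the only monomial in these variables that `Φ` adds. -/
structure IsSocleShape (p : σ → Prop) [DecidablePred p] (M : Set (σ →₀ ℕ)) (s : σ →₀ ℕ) :
    Prop where
  isUpperSet : IsUpperSet M
  filter_eq : s.filter p = s
  notMem : s ∉ M
  add_single_mem : ∀ i, p i → s + Finsupp.single i 1 ∈ M
  filter_mem_or_eq : ∀ c ∈ M, c.filter p ∈ M ∨ c.filter p = s
  exists_filter_eq : ∃ c ∈ M, c.filter p = s

theorem mem_or_eq_of_le_filter (hM : IsUpperSet M) (hs : s.filter p = s)
    (hadd : ∀ i, p i → s + Finsupp.single i 1 ∈ M) {c : σ →₀ ℕ} (hsc : s ≤ c.filter p) :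
    c.filter p ∈ M ∨ c.filter p = s := by
  obtain ⟨d, hd⟩ := exists_add_of_le hsc
  have hdp : d.filter p = d := by
    apply add_left_cancel (a := s)
    nth_rewrite 1 [← hs]
    rw [← Finsupp.filter_add, ← hd, finsupp_filter_filter_self]
  rcases eq_or_ne d 0 with rfl | hd0
  · exact .inr (hd.trans (add_zero s))
  obtain ⟨i, hi⟩ := Finsupp.ne_iff.1 hd0
  refine .inl (hM ?_ (hadd i ((Finsupp.filter_eq_self_iff p d).1 hdp i hi)))
  rw [hd]
  gcongr
  exact Finsupp.single_le_iff.2 (Nat.one_le_iff_ne_zero.2 hi)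

end SocleShape

section Projection

variable {k : Type*} [Field k] {n r : ℕ} {J : Ideal (MvPolynomial (Fin n) k)}

theorem projVars_eq_killCompl (hrn : r ≤ n) :
    projVars k n r = killCompl (Fin.castLE_injective hrn) := by
  ext1 i
  rw [projVars, aeval_X]
  split_ifs with hi
  · rw [← killCompl_rename_app (Fin.castLE_injective hrn) (X ⟨i, hi⟩), rename_X]
    rfl
  · rw [X, killCompl_monomial_eq_zero_of_not_subset]
    intro h
    obtain ⟨j, rfl⟩ := h ((Finsupp.mem_support_single i i 1).2 ⟨rfl, one_ne_zero⟩)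
    exact hi j.isLt

theorem exists_mapDomain_castLE_eq_iff (hrn : r ≤ n) (c : Fin n →₀ ℕ) :
    (∃ a : Fin r →₀ ℕ, a.mapDomain (Fin.castLE hrn) = c) ↔ (c.filter fun i => i.val < r) = c := by
  rw [Finsupp.filter_eq_self_iff]
  constructor
  · rintro ⟨a, rfl⟩ i hi
    obtain ⟨j, -, rfl⟩ :=
      Finset.mem_image.1 (Finsupp.mapDomain_support (Finsupp.mem_support_iff.2 hi))
    exact j.isLt
  · intro hc
    refine ⟨c.comapDomain _ (Fin.castLE_injective hrn).injOn,
      Finsupp.mapDomain_comapDomain _ (Fin.castLE_injective hrn) c fun i hi => ?_⟩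
    exact ⟨⟨i, hc i (Finsupp.mem_support_iff.1 hi)⟩, rfl⟩

theorem Phi_eq_span (r : ℕ) (J : Ideal (MvPolynomial (Fin n) k)) : Phi r J =
    Ideal.span ((fun c => monomial c 1) ''
      ((fun b => b.filter fun i => i.val < r) '' minimalMonomials J)) := by
  rw [Set.image_image]
  rfl

theorem exists_filter_le_iff_of_PhiBar_eq (hrn : r ≤ n) (hJ : IsMonomialIdeal J) {a : Fin r →₀ ℕ}
    (hPhi : PhiBar r J = J.map (projVars k n r) ⊔ Ideal.span {monomial a 1}) {c : Fin n →₀ ℕ}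
    (hc : (c.filter fun i => i.val < r) = c) :
    (∃ b ∈ minimalMonomials J, (b.filter fun i => i.val < r) ≤ c) ↔
      c ∈ exponents J ∨ a.mapDomain (Fin.castLE hrn) ≤ c := by
  obtain ⟨c, rfl⟩ := (exists_mapDomain_castLE_eq_iff hrn c).2 hc
  have hinj := Fin.castLE_injective hrn
  have hc := congrArg (c ∈ exponents ·) hPhi
  rw [PhiBar, Phi_eq_span, projVars_eq_killCompl hrn, eq_iff_iff,
    (isMonomialIdeal_span _).mem_exponents_map_killCompl_iff hinj, mem_exponents_span_iff,
    (hJ.map_killCompl hinj).mem_exponents_sup_iff (isMonomialIdeal_span_singleton a),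
    hJ.mem_exponents_map_killCompl_iff hinj, mem_exponents_span_singleton_iff,
    Set.exists_mem_image, ← Finsupp.mapDomain_le_mapDomain_iff_le hinj] at hc
  exact hc

theorem isSocleShape_exponents (hrn : r ≤ n) (hJ : IsMonomialIdeal J) {a : Fin r →₀ ℕ}
    (hcolon : monomial a 1 ∈ (J.map (projVars k n r)).colon (maxHomogeneousIdeal k r))
    (hnot : monomial a 1 ∉ J.map (projVars k n r))
    (hPhi : PhiBar r J = J.map (projVars k n r) ⊔ Ideal.span {monomial a 1}) :
    IsSocleShape (fun i : Fin n => i.val < r) (exponents J) (a.mapDomain (Fin.castLE hrn)) := by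
  have hPhi' := fun {c} => exists_filter_le_iff_of_PhiBar_eq hrn hJ hPhi (c := c)
  set s := a.mapDomain (Fin.castLE hrn) with hs_def
  have hM := isUpperSet_exponents J
  have hs : (s.filter fun i => i.val < r) = s := (exists_mapDomain_castLE_eq_iff hrn s).1 ⟨a, rfl⟩
  rw [projVars_eq_killCompl hrn] at hcolon hnot
  rw [hJ.mem_map_killCompl_iff, rename_monomial] at hnot
  have hadd : ∀ i : Fin n, i.val < r → s + Finsupp.single i 1 ∈ exponents J := by
    intro i hi
    have hX := Submodule.mem_colon.1 hcolon (X ⟨i, hi⟩) (Ideal.subset_span ⟨_, rfl⟩)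
    rwa [smul_eq_mul, hJ.mem_map_killCompl_iff, map_mul, rename_monomial, rename_X, X,
      monomial_mul, one_mul] at hX
  have hmin : ∀ b ∈ minimalMonomials J, (b.filter fun i => i.val < r) ∈ exponents J ∨
      (b.filter fun i => i.val < r) = s := fun b hb =>
    ((hPhi' (finsupp_filter_filter_self _ b)).1 ⟨b, hb, le_rfl⟩).elim .inl
      (mem_or_eq_of_le_filter hM hs hadd)
  refine ⟨hM, hs, hnot, hadd, fun c hc => ?_, ?_⟩
  · obtain ⟨b, hbc, hb⟩ := exists_minimal_le_of_wellFoundedLT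
      (fun b => monomial b (1 : k) ∈ J) c hc
    rcases hmin b hb with h | h
    · exact .inl (hM (finsupp_filter_mono hbc) h)
    · exact mem_or_eq_of_le_filter hM hs hadd (h ▸ finsupp_filter_mono hbc)
  · obtain ⟨b, hb, hbs⟩ := (hPhi' hs).2 (.inr le_rfl)
    exact ⟨b, hb.1, (hmin b hb).resolve_left fun h => hnot (hM hbs h)⟩

end Projection

section LeadingExponents

open scoped MonomialOrder

variable {σ k : Type*} [Field k] {m : MonomialOrder σ} {Q : Ideal (MvPolynomial σ k)}

/-- The exponents of the leading monomials of the nonzero elements of `Q`, that is, the exponents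
of the initial ideal of `Q`. -/
def leadingExponents (m : MonomialOrder σ) (Q : Ideal (MvPolynomial σ k)) : Set (σ →₀ ℕ) :=
  {c | ∃ f ∈ Q, f ≠ 0 ∧ m.degree f = c}

theorem isUpperSet_leadingExponents (m : MonomialOrder σ) (Q : Ideal (MvPolynomial σ k)) :
    IsUpperSet (leadingExponents m Q) := by
  classical
  rintro c d hcd ⟨f, hf, hf0, rfl⟩
  have h0 : monomial (d - m.degree f) (1 : k) ≠ 0 := monomial_eq_zero.not.2 one_ne_zero
  refine ⟨_, Q.mul_mem_left (monomial (d - m.degree f) 1) hf, mul_ne_zero h0 hf0, ?_⟩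
  rw [m.degree_mul h0 hf0, m.degree_monomial, if_neg one_ne_zero, tsub_add_cancel_of_le hcd]

/-- Subtracting its remainder modulo `Q` from `x^c` gives an element of `Q` whose other monomials
are all standard. -/
theorem exists_reduced_of_mem_leadingExponents {c : σ →₀ ℕ} (hc : c ∈ leadingExponents m Q) :
    ∃ f ∈ Q, f ≠ 0 ∧ m.degree f = c ∧ ∀ d ∈ f.support, d = c ∨ d ∉ leadingExponents m Q := by
  classical
  obtain ⟨q, t, hqt, hdeg, ht⟩ := m.div_set (B := {f | f ∈ Q ∧ f ≠ 0})
    (fun b hb => (m.leadingCoeff_ne_zero_iff.2 hb.2).isUnit) (monomial c (1 : k))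
  have hstd : ∀ d ∈ t.support, d ∉ leadingExponents m Q := by
    rintro d hd ⟨f, hf, hf0, rfl⟩
    exact ht _ hd f ⟨hf, hf0⟩ le_rfl
  have hcoeff : ∀ d, coeff d (monomial c 1 - t) = (if c = d then 1 else 0) - coeff d t :=
    fun d => by rw [coeff_sub, coeff_monomial]
  have hcf : c ∈ (monomial c 1 - t).support := by
    rw [mem_support_iff, hcoeff, if_pos rfl,
      notMem_support_iff.1 (mt (hstd c) (not_not.2 hc)), sub_zero]
    exact one_ne_zero
  have hred : ∀ d ∈ (monomial c 1 - t).support, d = c ∨ d ∉ leadingExponents m Q := by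
    refine fun d hd => or_iff_not_imp_left.2 fun hdc => hstd d (mem_support_iff.2 fun h0 => ?_)
    rw [mem_support_iff, hcoeff, if_neg (Ne.symm hdc), h0, sub_zero] at hd
    exact hd rfl
  have hsub : monomial c 1 - t =
      Finsupp.linearCombination _ (fun b : {f | f ∈ Q ∧ f ≠ 0} => (b : MvPolynomial σ k)) q :=
    sub_eq_iff_eq_add.2 hqt
  refine ⟨monomial c 1 - t, hsub ▸ Q.sum_mem fun b _ => Q.mul_mem_left _ b.2.1,
    support_nonempty.1 ⟨c, hcf⟩, m.toSyn.injective (le_antisymm ?_ (m.le_degree hcf)), hred⟩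
  rw [hsub, Finsupp.linearCombination_apply, Finsupp.sum]
  refine m.degree_sum_le.trans (Finset.sup_le fun b _ => ?_)
  have hb := hdeg b
  rwa [m.degree_monomial, if_neg one_ne_zero, mul_comm, ← smul_eq_mul] at hb

end LeadingExponents

section InitialIdeal

variable {k : Type*} [Field k] {n : ℕ} (m : MonomialOrder (Fin n))
  (Q : Ideal (MvPolynomial (Fin n) k))

theorem initialIdeal_eq_span :
    initialIdeal m Q = Ideal.span ((fun c => monomial c 1) '' leadingExponents m Q) := by
  unfold initialIdeal
  congr 1
  ext g
  constructor
  · rintro ⟨f, hf, hf0, rfl⟩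
    exact ⟨_, ⟨f, hf, hf0, rfl⟩, rfl⟩
  · rintro ⟨_, ⟨f, hf, hf0, rfl⟩, rfl⟩
    exact ⟨f, hf, hf0, rfl⟩

theorem isMonomialIdeal_initialIdeal : IsMonomialIdeal (initialIdeal m Q) :=
  initialIdeal_eq_span m Q ▸ isMonomialIdeal_span _

theorem exponents_initialIdeal : exponents (initialIdeal m Q) = leadingExponents m Q := by
  ext c
  rw [initialIdeal_eq_span, mem_exponents_span_iff]
  exact ⟨fun ⟨t, ht, htc⟩ => isUpperSet_leadingExponents m Q htc ht, fun h => ⟨c, h, le_rfl⟩⟩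

end InitialIdeal

namespace IsSocleShape

open scoped MonomialOrder

variable {σ k : Type*} [Field k] {p : σ → Prop} [DecidablePred p] {s : σ →₀ ℕ}

theorem divMonomial_mem_supported {M : Set (σ →₀ ℕ)} (h : IsSocleShape p M s)
    {f : MvPolynomial σ k} (hf : f ∈ filterSupported k p Mᶜ) :
    f.divMonomial s ∈ supported k {i | ¬ p i} := by
  refine mem_supported_setOf_not_iff.2 fun c hc => (Finsupp.filter_eq_zero_iff _ _).2 fun i hi => ?_
  by_contra hci
  rw [mem_support_iff, coeff_divMonomial, ← mem_support_iff] at hc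
  refine hf hc (h.isUpperSet ?_ (h.add_single_mem i hi))
  rw [Finsupp.filter_add, h.filter_eq]
  gcongr
  rw [Finsupp.single_le_iff, Finsupp.filter_apply_pos p c hi]
  exact Nat.one_le_iff_ne_zero.2 hci

variable {m : MonomialOrder σ} {Q : Ideal (MvPolynomial σ k)}
  (h : IsSocleShape p (leadingExponents m Q) s)
include h

theorem divMonomial_ne_zero_and_degree_eq {f : MvPolynomial σ k}
    (hf : f ∈ filterSupported k p (leadingExponents m Q)ᶜ) (hfQ : f ∈ Q) (hf0 : f ≠ 0) :
    f.divMonomial s ≠ 0 ∧ m.degree f = s + m.degree (f.divMonomial s) := by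
  have hlead := m.degree_mem_support hf0
  have hs : (m.degree f).filter p = s :=
    (h.filter_mem_or_eq _ ⟨f, hfQ, hf0, rfl⟩).resolve_left (hf hlead)
  obtain ⟨t, ht⟩ := exists_add_of_le (hs ▸ finsupp_filter_le p (m.degree f) : s ≤ m.degree f)
  have hsupp : ∀ c, c ∈ (f.divMonomial s).support ↔ s + c ∈ f.support := fun c => by
    rw [mem_support_iff, mem_support_iff, coeff_divMonomial]
  have htsupp : t ∈ (f.divMonomial s).support := (hsupp t).2 (ht ▸ hlead)
  refine ⟨support_nonempty.1 ⟨t, htsupp⟩, ht.trans (congrArg (s + ·) ?_)⟩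
  apply m.toSyn.injective
  refine le_antisymm (m.le_degree htsupp) (m.degree_le_iff.2 fun c hc => ?_)
  have hle := m.le_degree ((hsupp c).1 hc)
  rw [ht, map_add, map_add] at hle
  exact le_of_add_le_add_left hle

theorem eq_zero_of_mem_supported (hs : s ≠ 0) {f : MvPolynomial σ k}
    (hf : f ∈ supported k {i | ¬ p i}) (hfQ : f ∈ Q) : f = 0 := by
  by_contra hf0
  have hlow := mem_supported_setOf_not_iff.1 hf _ (m.degree_mem_support hf0)
  rcases h.filter_mem_or_eq _ ⟨f, hfQ, hf0, rfl⟩ with hmem | heq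
  · exact h.notMem (h.isUpperSet zero_le (hlow ▸ hmem))
  · exact hs (heq.symm.trans hlow)

theorem exists_mem_filterSupported_degree_eq {c : σ →₀ ℕ} (hc : c ∈ leadingExponents m Q)
    (hcp : c.filter p ∉ leadingExponents m Q) :
    ∃ f ∈ Q, f ∈ filterSupported k p (leadingExponents m Q)ᶜ ∧ f ≠ 0 ∧ m.degree f = c := by
  obtain ⟨f, hfQ, hf0, hfc, hf⟩ := exists_reduced_of_mem_leadingExponents hc
  refine ⟨f, hfQ, fun d hd hdM => ?_, hf0, hfc⟩
  rcases hf d hd with rfl | hd'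
  · exact hcp hdM
  · exact hd' (h.isUpperSet (finsupp_filter_le p d) hdM)

theorem mem_of_mul_mem (hs : s ≠ 0) (hQ : Q.IsPrimary) {d q : MvPolynomial σ k} (hd0 : d ≠ 0)
    (hd : d ∈ supported k {i | ¬ p i}) (hdq : d * q ∈ Q) : q ∈ Q := by
  refine ((Ideal.isPrimary_iff.1 hQ).2 (mul_comm d q ▸ hdq)).resolve_right ?_
  rintro ⟨j, hj⟩
  exact pow_ne_zero j hd0 (h.eq_zero_of_mem_supported hs (pow_mem hd j) hj)

/-- If `d` divides both `f` and its `x^s`-coefficient, then `f / d` is again in `Q`, so that no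
nonunit `d` exists when the `x^s`-coefficient of `f` is minimal for divisibility. -/
theorem exists_isRelPrime (hs : s ≠ 0) (hQ : Q.IsPrimary) :
    ∃ f ∈ Q, f ∈ filterSupported k p (leadingExponents m Q)ᶜ ∧ f ≠ 0 ∧
      IsRelPrime (f.divMonomial s) f := by
  obtain ⟨c, hc, hcs⟩ := h.exists_filter_eq
  obtain ⟨f₁, hf₁Q, hf₁, hf₁0, -⟩ := h.exists_mem_filterSupported_degree_eq hc (hcs ▸ h.notMem)
  obtain ⟨_, ⟨f, ⟨hfQ, hf, hf0⟩, rfl⟩, hmin⟩ :=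
    (IsWellFounded.wf (r := DvdNotUnit (α := MvPolynomial σ k))).has_min
      ((fun f => f.divMonomial s) ''
        {f | f ∈ Q ∧ f ∈ filterSupported k p (leadingExponents m Q)ᶜ ∧ f ≠ 0})
      ⟨_, f₁, ⟨hf₁Q, hf₁, hf₁0⟩, rfl⟩
  refine ⟨f, hfQ, hf, hf0, ?_⟩
  rintro d hdg ⟨q, rfl⟩
  have hd0 := left_ne_zero_of_mul hf0
  have hd := mem_supported_of_dvd (h.divMonomial_ne_zero_and_degree_eq hf hfQ hf0).1
    (h.divMonomial_mem_supported hf) hdg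
  have hqQ := h.mem_of_mul_mem hs hQ hd0 hd hfQ
  have hq := mem_filterSupported_of_mul_mem hd0 hd hf
  have hq0 := right_ne_zero_of_mul hf0
  by_contra hunit
  refine hmin _ ⟨q, ⟨hqQ, hq, hq0⟩, rfl⟩
    ⟨(h.divMonomial_ne_zero_and_degree_eq hq hqQ hq0).1, d, hunit, ?_⟩
  exact (mul_divMonomial_of_mem_supported h.filter_eq hd q).trans (mul_comm _ _)

/-- The cross combination `g * f' - g' * f` of two elements with `x^s`-coefficients `g` and `g'`
has `x^s`-coefficient zero, so it vanishes. -/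
theorem divMonomial_mul_eq {f f' : MvPolynomial σ k}
    (hf : f ∈ filterSupported k p (leadingExponents m Q)ᶜ) (hfQ : f ∈ Q)
    (hf' : f' ∈ filterSupported k p (leadingExponents m Q)ᶜ) (hf'Q : f' ∈ Q) :
    f.divMonomial s * f' = f'.divMonomial s * f := by
  have hg := h.divMonomial_mem_supported hf
  have hg' := h.divMonomial_mem_supported hf'
  by_contra hne
  refine (h.divMonomial_ne_zero_and_degree_eq
    (sub_mem (mul_mem_filterSupported hg hf') (mul_mem_filterSupported hg' hf))
    (sub_mem (Q.mul_mem_left _ hf'Q) (Q.mul_mem_left _ hfQ)) (sub_ne_zero.2 hne)).1 ?_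
  have hadd := add_divMonomial (f.divMonomial s * f' - f'.divMonomial s * f)
    (f'.divMonomial s * f) s
  rw [sub_add_cancel, mul_divMonomial_of_mem_supported h.filter_eq hg,
    mul_divMonomial_of_mem_supported h.filter_eq hg', mul_comm] at hadd
  exact right_eq_add.1 hadd

theorem exists_isLeast (hs : s ≠ 0) (hQ : Q.IsPrimary) :
    ∃ f ∈ Q, f ∈ filterSupported k p (leadingExponents m Q)ᶜ ∧ f ≠ 0 ∧
      IsLeast {c | c ∈ leadingExponents m Q ∧ c.filter p ∉ leadingExponents m Q} (m.degree f) := by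
  obtain ⟨f, hfQ, hf, hf0, hrel⟩ := h.exists_isRelPrime hs hQ
  refine ⟨f, hfQ, hf, hf0, ⟨⟨f, hfQ, hf0, rfl⟩, hf (m.degree_mem_support hf0)⟩, ?_⟩
  rintro c ⟨hc, hcp⟩
  obtain ⟨f', hf'Q, hf', hf'0, rfl⟩ := h.exists_mem_filterSupported_degree_eq hc hcp
  obtain ⟨q, hq⟩ : f.divMonomial s ∣ f'.divMonomial s :=
    hrel.dvd_of_dvd_mul_right ⟨f', (h.divMonomial_mul_eq hf hfQ hf' hf'Q).symm⟩
  obtain ⟨hg'0, hdeg'⟩ := h.divMonomial_ne_zero_and_degree_eq hf' hf'Q hf'0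
  rw [hq] at hg'0
  rw [hdeg', (h.divMonomial_ne_zero_and_degree_eq hf hfQ hf0).2, hq,
    m.degree_mul (left_ne_zero_of_mul hg'0) (right_ne_zero_of_mul hg'0), ← add_assoc]
  exact le_self_add

end IsSocleShape

section LinearForms

variable {σ τ R : Type*} [CommSemiring R]

theorem finsupp_eq_single_degree {p : σ} {c : σ →₀ ℕ} (h : ∀ i, i ≠ p → c i = 0) :
    c = Finsupp.single p c.degree := by
  have hcp : c = Finsupp.single p (c p) := Finsupp.support_subset_singleton.1 fun i hi =>
    Finset.mem_singleton.2 (not_imp_comm.1 (h i) (Finsupp.mem_support_iff.1 hi))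
  have hdeg : c.degree = c p := (congrArg Finsupp.degree hcp).trans (Finsupp.degree_single p _)
  rwa [hdeg]

theorem coeff_single_eq_eval [DecidableEq σ] {f : MvPolynomial σ R} {e : ℕ}
    (hf : f.IsHomogeneous e) (p : σ) :
    coeff (Finsupp.single p e) f = eval (Pi.single p 1) f := by
  rw [eval_eq, Finset.sum_eq_single (Finsupp.single p e)]
  · rw [Finset.prod_eq_one, mul_one]
    intro i hi
    obtain rfl := Finset.mem_singleton.1 (Finsupp.support_single_subset hi)
    rw [Pi.single_eq_same, one_pow]
  · intro c hc hce
    obtain ⟨i, hip, hci⟩ : ∃ i, i ≠ p ∧ c i ≠ 0 := by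
      by_contra! hall
      have hdeg := hf.degree_eq_sum_deg_support hc
      exact hce (hdeg ▸ finsupp_eq_single_degree hall)
    rw [Finset.prod_eq_zero (Finsupp.mem_support_iff.2 hci), mul_zero]
    rw [Pi.single_eq_of_ne hip, zero_pow hci]
  · intro hc
    rw [notMem_support_iff.1 hc, zero_mul]

theorem homogeneousComponent_totalDegree_ne_zero {f : MvPolynomial σ R} (hf : f ≠ 0) :
    homogeneousComponent f.totalDegree f ≠ 0 := by
  obtain ⟨c, hc, hcd⟩ := Finset.exists_mem_eq_sup f.support (support_nonempty.2 hf) Finsupp.degree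
  refine support_nonempty.1 ⟨c, ?_⟩
  rw [support_homogeneousComponent, Finset.mem_filter]
  exact ⟨hc, hcd.symm⟩

variable {g : σ → MvPolynomial τ R} (hg : ∀ i, (g i).IsHomogeneous 1)
include hg

theorem homogeneousComponent_aeval (e : ℕ) (f : MvPolynomial σ R) :
    homogeneousComponent e (aeval g f) = aeval g (homogeneousComponent e f) := by
  induction f using MvPolynomial.induction_on' with
  | monomial c a =>
    have hc := isHomogeneous_monomial a (rfl : c.degree = c.degree)
    have hcg := hc.aeval g hg
    rw [one_mul] at hcg
    rw [homogeneousComponent_of_mem hc, homogeneousComponent_of_mem hcg]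
    split_ifs
    · rfl
    · rw [map_zero]
  | add f f' hf hf' => simp only [map_add, hf, hf']

theorem totalDegree_aeval_le (f : MvPolynomial σ R) :
    (aeval g f).totalDegree ≤ f.totalDegree := by
  refine Finset.sup_le fun c hc => not_lt.1 fun hlt => mem_support_iff.1 hc ?_
  have hzero := homogeneousComponent_aeval hg c.degree f
  rw [homogeneousComponent_eq_zero c.degree f hlt, map_zero] at hzero
  rw [← coeff_zero c, ← hzero, coeff_homogeneousComponent, if_pos rfl]

end LinearForms

section LinearSubst

variable {k : Type*} [Field k] {n : ℕ}

theorem linearSubst_X (α : GL (Fin n) k) (j : Fin n) :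
    linearSubst α (X j) = ∑ i, C (α.val i j) * X i := aeval_X _ _

theorem linearSubst_mul (β α : GL (Fin n) k) :
    linearSubst (β * α) = (linearSubst β).comp (linearSubst α) := by
  ext1 j
  simp_rw [AlgHom.comp_apply, linearSubst_X, map_sum, map_mul, algHom_C, algebraMap_eq,
    linearSubst_X, Units.val_mul, Matrix.mul_apply, map_sum, Finset.mul_sum, Finset.sum_mul]
  rw [Finset.sum_comm]
  refine Finset.sum_congr rfl fun i _ => Finset.sum_congr rfl fun l _ => ?_
  rw [map_mul]
  ring

theorem linearSubst_one : linearSubst (1 : GL (Fin n) k) = AlgHom.id k _ := by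
  ext1 j
  rw [linearSubst_X, Units.val_one, AlgHom.id_apply,
    Finset.sum_eq_single_of_mem j (Finset.mem_univ j) fun i _ hi => by
      rw [Matrix.one_apply_ne hi, C_0, zero_mul]]
  rw [Matrix.one_apply_eq, C_1, one_mul]

/-- A linear change of coordinates as an automorphism. -/
noncomputable def linearSubstEquiv (α : GL (Fin n) k) :
    MvPolynomial (Fin n) k ≃ₐ[k] MvPolynomial (Fin n) k :=
  AlgEquiv.ofAlgHom (linearSubst α) (linearSubst α⁻¹)
    (by rw [← linearSubst_mul, mul_inv_cancel, linearSubst_one])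
    (by rw [← linearSubst_mul, inv_mul_cancel, linearSubst_one])

theorem isPrimary_map_linearSubst (α : GL (Fin n) k) {P : Ideal (MvPolynomial (Fin n) k)}
    (hP : P.IsPrimary) : (P.map (linearSubst α)).IsPrimary := by
  have hcomap : P.map (linearSubst α) = P.comap (linearSubstEquiv α).symm.toRingHom :=
    (Ideal.comap_symm (linearSubstEquiv α).toRingEquiv).symm
  exact hcomap ▸ hP.comap _

theorem isHomogeneous_linearSubst_X (α : GL (Fin n) k) (j : Fin n) :
    (∑ i, C (α.val i j) * X i : MvPolynomial (Fin n) k).IsHomogeneous 1 :=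
  IsHomogeneous.sum _ _ _ fun i _ => isHomogeneous_C_mul_X _ i

theorem totalDegree_linearSubst_le (α : GL (Fin n) k) (f : MvPolynomial (Fin n) k) :
    (linearSubst α f).totalDegree ≤ f.totalDegree :=
  totalDegree_aeval_le (isHomogeneous_linearSubst_X α) f

theorem coeff_single_linearSubst (α : GL (Fin n) k) (p : Fin n) (e : ℕ)
    (f : MvPolynomial (Fin n) k) :
    coeff (Finsupp.single p e) (linearSubst α f) =
      eval (α.val p) (homogeneousComponent e f) := by
  have hcomp : homogeneousComponent e (linearSubst α f) =
      linearSubst α (homogeneousComponent e f) :=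
    homogeneousComponent_aeval (isHomogeneous_linearSubst_X α) e f
  have heval : (aeval (Pi.single p 1)).comp (linearSubst α) = aeval (R := k) (α.val p) := by
    ext1 j
    rw [AlgHom.comp_apply, linearSubst_X, map_sum, aeval_X,
      Finset.sum_eq_single_of_mem p (Finset.mem_univ p) fun i _ hi => by
        rw [map_mul, aeval_X, Pi.single_eq_of_ne hi, mul_zero]]
    rw [map_mul, aeval_X, Pi.single_eq_same, mul_one, aeval_C]
    rfl
  calc coeff (Finsupp.single p e) (linearSubst α f)
      = coeff (Finsupp.single p e) (homogeneousComponent e (linearSubst α f)) := by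
        rw [coeff_homogeneousComponent, if_pos (Finsupp.degree_single p e)]
    _ = eval (Pi.single p 1) (linearSubst α (homogeneousComponent e f)) := by
        rw [coeff_single_eq_eval (homogeneousComponent_isHomogeneous e _), hcomp]
    _ = eval (α.val p) (homogeneousComponent e f) := DFunLike.congr_fun heval _

end LinearSubst

section GenericRow

open scoped MonomialOrder

theorem det_updateRow_one {ι R : Type*} [Fintype ι] [DecidableEq ι] [CommRing R] (p : ι)
    (d : ι → R) : ((1 : Matrix ι ι R).updateRow p d).det = d p := by
  rw [← Matrix.cramer_transpose_apply, Matrix.transpose_one, Matrix.cramer_one]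
  rfl

theorem updateRow_one_single {ι R : Type*} [DecidableEq ι] [Semiring R] (p : ι) :
    (1 : Matrix ι ι R).updateRow p (Pi.single p 1) = 1 := by
  have hrow : (1 : Matrix ι ι R) p = Pi.single p 1 := funext fun j => Matrix.one_eq_pi_single
  rw [← hrow, Matrix.updateRow_eq_self]

theorem eval_eq_of_mem_supported {σ R : Type*} [CommSemiring R] {s : Set σ} {f : MvPolynomial σ R}
    (hf : f ∈ supported R s) {x y : σ → R} (hxy : ∀ i ∈ s, x i = y i) : eval x f = eval y f :=
  eval₂Hom_congr' rfl (fun i hi _ => hxy i (mem_supported.1 hf hi)) rfl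

variable {k : Type*} [Field k] {n : ℕ}

theorem degRevLex_lt_single {p : Fin n} {e : ℕ} {c : Fin n →₀ ℕ} (hcp : ∀ i < p, c i = 0)
    (hce : c.degree ≤ e) (hne : c ≠ Finsupp.single p e) :
    c ≺[degRevLex n] Finsupp.single p e := by
  rw [degRevLex_lt_iff, Finsupp.degree_single]
  refine hce.lt_or_eq.imp_right fun heq => ⟨heq, ?_⟩
  obtain ⟨i, hi⟩ : ∃ i, i ∈ c.support ∧ i ≠ p := by
    by_contra! hall
    refine hne (heq ▸ finsupp_eq_single_degree fun i hip => ?_)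
    exact Finsupp.notMem_support_iff.1 fun hi => hip (hall i hi)
  obtain ⟨l, hl, hmax⟩ := (c.support.filter (· ≠ p)).exists_max_image id
    ⟨i, Finset.mem_filter.2 hi⟩
  obtain ⟨hlc, hlp⟩ := Finset.mem_filter.1 hl
  have hpl : p < l := lt_of_le_of_ne
    (not_lt.1 fun hlt => Finsupp.mem_support_iff.1 hlc (hcp l hlt)) hlp.symm
  refine ⟨l, ?_, fun j hj => ?_⟩
  · rw [Finsupp.single_eq_of_ne hlp]
    exact Nat.pos_of_ne_zero (Finsupp.mem_support_iff.1 hlc)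
  · rw [Finsupp.single_eq_of_ne (hpl.trans hj).ne']
    by_contra hcj
    exact hj.not_ge (hmax j (Finset.mem_filter.2
      ⟨Finsupp.mem_support_iff.2 hcj, (hpl.trans hj).ne'⟩))

theorem degree_degRevLex_eq_single {p : Fin n} {e : ℕ} {g : MvPolynomial (Fin n) k}
    (hg : g ∈ supported k {i : Fin n | ¬ i.val < p.val}) (he : g.totalDegree ≤ e)
    (hcoeff : coeff (Finsupp.single p e) g ≠ 0) :
    (degRevLex n).degree g = Finsupp.single p e := by
  apply (degRevLex n).toSyn.injective
  refine le_antisymm ((degRevLex n).degree_le_iff.2 fun c hc => ?_)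
    ((degRevLex n).le_degree (mem_support_iff.2 hcoeff))
  rcases eq_or_ne c (Finsupp.single p e) with rfl | hne
  · exact le_rfl
  · have hcp := (Finsupp.filter_eq_zero_iff _ _).1 (mem_supported_setOf_not_iff.1 hg c hc)
    exact (degRevLex_lt_single hcp ((le_totalDegree hc).trans he) hne).le

section UpdateRow

variable {β : GL (Fin n) k} {p : Fin n} {d : Fin n → k}
  (hβ : β.val = (1 : Matrix (Fin n) (Fin n) k).updateRow p d)
include hβ

theorem linearSubst_X_eq_self_of_updateRow_one {j : Fin n} (hjp : j ≠ p) (hj : d j = 0) :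
    linearSubst β (X j) = X j := by
  rw [linearSubst_X, Finset.sum_eq_single_of_mem j (Finset.mem_univ j)]
  · rw [hβ, Matrix.updateRow_ne hjp, Matrix.one_apply_eq, C_1, one_mul]
  · intro i _ hi
    rw [hβ, Matrix.updateRow_apply]
    split_ifs
    · rw [hj, C_0, zero_mul]
    · rw [Matrix.one_apply_ne hi, C_0, zero_mul]

theorem linearSubst_X_mem_supported_of_updateRow_one {s : Set (Fin n)} (hp : p ∈ s) {j : Fin n}
    (hj : j ∈ s) : linearSubst β (X j) ∈ supported k s := by
  rw [linearSubst_X]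
  refine sum_mem fun i _ => ?_
  by_cases hi : i ∈ s
  · exact mul_mem (Subalgebra.algebraMap_mem _ _) (X_mem_supported.2 hi)
  · rw [hβ, Matrix.updateRow_ne (ne_of_mem_of_not_mem hp hi).symm,
      Matrix.one_apply_ne (ne_of_mem_of_not_mem hj hi).symm, C_0, zero_mul]
    exact zero_mem _

end UpdateRow

theorem exists_polynomial_of_isZariskiOpen {τ : Type*} {U : Set (GL (Fin n) k)}
    (hU : IsZariskiOpen U) (A : Matrix (Fin n) (Fin n) (MvPolynomial τ k)) {α : GL (Fin n) k}
    (hα : α ∈ U) {x₀ : τ → k} (hx₀ : α.val = A.map (eval x₀)) :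
    ∃ G : MvPolynomial τ k, eval x₀ G ≠ 0 ∧
      ∀ (x : τ → k) (γ : GL (Fin n) k), γ.val = A.map (eval x) → eval x G ≠ 0 → γ ∈ U := by
  obtain ⟨F, rfl⟩ := hU
  obtain ⟨f, hf, hfα⟩ := hα
  have hG : ∀ x, eval x (bind₁ (fun q : Fin n × Fin n => A q.1 q.2) f) =
      eval (fun q => A.map (eval x) q.1 q.2) f := fun x => eval₂Hom_bind₁ _ _ _ _
  refine ⟨bind₁ (fun q : Fin n × Fin n => A q.1 q.2) f, ?_, fun x γ hγ hx => ⟨f, hf, ?_⟩⟩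
  · rwa [hG, ← hx₀]
  · rwa [hγ, ← hG]

/-- The leading form of `g` and the equations of `U` do not vanish at a generic `p`-th row `d`. -/
theorem exists_updateRow_one_mem [Infinite k] {U : Set (GL (Fin n) k)}
    (hU : IsZariskiOpen U) {α : GL (Fin n) k} (hα : α ∈ U) {p : Fin n}
    {h : MvPolynomial (Fin n) k} (hh : h ∈ supported k {i : Fin n | ¬ i.val < p.val})
    (hh0 : h ≠ 0) :
    ∃ (β : GL (Fin n) k) (d : Fin n → k), (∀ j < p, d j = 0) ∧
      β.val = (1 : Matrix (Fin n) (Fin n) k).updateRow p d ∧ β * α ∈ U ∧ eval d h ≠ 0 := by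
  let d (x : Fin n → k) (j : Fin n) : k := if j < p then 0 else x j
  let A : Matrix (Fin n) (Fin n) (MvPolynomial (Fin n) k) :=
    (1 : Matrix _ _ _).updateRow p (fun j => if j < p then 0 else X j) * α.val.map C
  have hA : ∀ x, (1 : Matrix (Fin n) (Fin n) k).updateRow p (d x) * α.val = A.map (eval x) := by
    intro x
    have hα' : (α.val.map C).map (eval x) = α.val := by
      ext i j
      exact eval_C _
    have hd : eval x ∘ (fun j => if j < p then 0 else X j) = d x := by
      funext j
      exact (apply_ite (eval x) _ _ _).trans (by rw [map_zero, eval_X])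
    rw [Matrix.map_mul, hα', Matrix.map_updateRow, hd, Matrix.map_one _ (map_zero _) (map_one _)]
  have hα₀ : α.val = A.map (eval (Pi.single p 1)) := by
    have hd : d (Pi.single p 1) = Pi.single p 1 := by
      funext j
      refine ite_eq_right_iff.2 fun hj => ?_
      rw [Pi.single_eq_of_ne hj.ne]
    rw [← hA, hd, updateRow_one_single, one_mul]
  obtain ⟨G, hG, hGU⟩ := exists_polynomial_of_isZariskiOpen hU A hα hα₀
  have hG0 : G ≠ 0 := by
    rintro rfl
    exact hG (map_zero _)
  obtain ⟨x, hx⟩ : ∃ x, eval x (G * h * X p) ≠ 0 := by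
    by_contra! hall
    exact mul_ne_zero (mul_ne_zero hG0 hh0) (X_ne_zero p) (MvPolynomial.funext fun x => by
      rw [hall x, map_zero])
  rw [map_mul, map_mul, eval_X, mul_ne_zero_iff, mul_ne_zero_iff] at hx
  have hdet : ((1 : Matrix (Fin n) (Fin n) k).updateRow p (d x)).det ≠ 0 := by
    rw [det_updateRow_one]
    exact (if_neg (lt_irrefl p)).trans_ne hx.2
  refine ⟨Matrix.GeneralLinearGroup.mkOfDetNeZero _ hdet, d x, fun j hj => if_pos hj, rfl,
    hGU x _ (hA x) hx.1.1, ?_⟩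
  rw [eval_eq_of_mem_supported hh (x := d x) (y := x) fun i hi => if_neg hi]
  exact hx.1.2

theorem mem_supported_homogeneousComponent {σ R : Type*} [CommSemiring R] {s : Set σ}
    {f : MvPolynomial σ R} (hf : f ∈ supported R s) (e : ℕ) :
    homogeneousComponent e f ∈ supported R s := by
  classical
  refine mem_supported.2 fun i hi => mem_supported.1 hf ?_
  rw [Finset.mem_coe, mem_vars_iff_mem_support] at hi ⊢
  obtain ⟨c, hc, hic⟩ := hi
  rw [support_homogeneousComponent, Finset.mem_filter] at hc
  exact ⟨c, hc.1, hic⟩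

theorem exists_updateRow_one_degree_eq_single [Infinite k] {U : Set (GL (Fin n) k)}
    (hU : IsZariskiOpen U) {α : GL (Fin n) k} (hα : α ∈ U) {p : Fin n}
    {g : MvPolynomial (Fin n) k} (hg : g ∈ supported k {i : Fin n | ¬ i.val < p.val})
    (hg0 : g ≠ 0) :
    ∃ β : GL (Fin n) k, β * α ∈ U ∧ (∀ j : Fin n, j.val < p.val → linearSubst β (X j) = X j) ∧
      (∀ j : Fin n, ¬ j.val < p.val →
        linearSubst β (X j) ∈ supported k {i : Fin n | ¬ i.val < p.val}) ∧
      (degRevLex n).degree (linearSubst β g) = Finsupp.single p g.totalDegree := by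
  obtain ⟨β, d, hd, hβ, hβα, hdh⟩ := exists_updateRow_one_mem hU hα
    (mem_supported_homogeneousComponent hg g.totalDegree)
    (homogeneousComponent_totalDegree_ne_zero hg0)
  have hlt : ∀ j : Fin n, j.val < p.val → linearSubst β (X j) = X j := fun j hj =>
    linearSubst_X_eq_self_of_updateRow_one hβ (Fin.lt_def.2 hj).ne (hd j hj)
  have hge : ∀ j : Fin n, ¬ j.val < p.val →
      linearSubst β (X j) ∈ supported k {i : Fin n | ¬ i.val < p.val} := fun j hj =>
    linearSubst_X_mem_supported_of_updateRow_one hβ (lt_irrefl p.val) hj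
  refine ⟨β, hβα, hlt, hge, degree_degRevLex_eq_single ?_ (totalDegree_linearSubst_le β g) ?_⟩
  · exact map_mem_supported hge hg
  · rwa [coeff_single_linearSubst, hβ, Matrix.updateRow_self]

end GenericRow

section ExtraGenerator

open scoped MonomialOrder

variable {k : Type*} [Field k] {n : ℕ} {P J : Ideal (MvPolynomial (Fin n) k)}

theorem IsGenericInitialIdeal.isMonomialIdeal (hJ : IsGenericInitialIdeal P J) :
    IsMonomialIdeal J := by
  obtain ⟨U, -, ⟨α, hα⟩, hUJ⟩ := hJ
  exact hUJ α hα ▸ isMonomialIdeal_initialIdeal _ _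

variable {s : Fin n →₀ ℕ} {p : Fin n}
  (h : IsSocleShape (fun i : Fin n => i.val < p.val) (exponents J) s)
include h

theorem IsSocleShape.filter_add_single_eq (e : ℕ) :
    ((s + Finsupp.single p e).filter fun i : Fin n => i.val < p.val) = s := by
  rw [finsupp_filter_add_of_filter_eq_zero, h.filter_eq]
  exact Finsupp.filter_single_of_neg (fun i : Fin n => i.val < p.val) (lt_irrefl p.val)

theorem IsSocleShape.add_single_mem_of_isZariskiOpen [Infinite k] {U : Set (GL (Fin n) k)}
    (hU : IsZariskiOpen U)
    (hUJ : ∀ α ∈ U, leadingExponents (degRevLex n) (P.map (linearSubst α)) = exponents J)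
    {α : GL (Fin n) k} (hα : α ∈ U) {f : MvPolynomial (Fin n) k}
    (hf : f ∈ filterSupported k (fun i : Fin n => i.val < p.val) (exponents J)ᶜ)
    (hfQ : f ∈ P.map (linearSubst α)) (hf0 : f ≠ 0) :
    s + Finsupp.single p (f.divMonomial s).totalDegree ∈ exponents J := by
  have hshape {γ} (hγ : γ ∈ U) := (hUJ γ hγ).symm ▸ h
  have hg0 := ((hshape hα).divMonomial_ne_zero_and_degree_eq (hUJ α hα ▸ hf) hfQ hf0).1
  obtain ⟨β, hβα, hlt, hge, hdegβ⟩ :=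
    exists_updateRow_one_degree_eq_single hU hα (h.divMonomial_mem_supported hf) hg0
  have hβf : linearSubst β f ∈ P.map (linearSubst (β * α)) := by
    rw [linearSubst_mul, ← Ideal.map_mapₐ]
    exact Ideal.mem_map_of_mem _ hfQ
  have hβ0 : linearSubst β f ≠ 0 := (map_ne_zero_iff _ (linearSubstEquiv β).injective).2 hf0
  have hdeg := ((hshape hβα).divMonomial_ne_zero_and_degree_eq
    (hUJ _ hβα ▸ map_mem_filterSupported hlt hge hf) hβf hβ0).2
  rw [map_divMonomial hlt hge h.filter_eq, hdegβ] at hdeg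
  rw [← hdeg, ← hUJ _ hβα]
  exact ⟨_, hβf, hβ0, rfl⟩

theorem IsSocleShape.exists_isLeast_add_single [Infinite k] (hs : s ≠ 0) (hP : P.IsPrimary)
    (hJ : IsGenericInitialIdeal P J) :
    ∃ e, 0 < e ∧ IsLeast {c | c ∈ exponents J ∧
      (c.filter fun i => i.val < p.val) ∉ exponents J} (s + Finsupp.single p e) := by
  obtain ⟨U, hU, ⟨α, hα⟩, hUJ⟩ := hJ
  have hlead : ∀ γ ∈ U, leadingExponents (degRevLex n) (P.map (linearSubst γ)) = exponents J :=
    fun γ hγ => by rw [← exponents_initialIdeal, hUJ γ hγ]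
  have hα' := hlead α hα
  obtain ⟨f, hfQ, hf, hf0, hleast⟩ :=
    (hα'.symm ▸ h).exists_isLeast hs (isPrimary_map_linearSubst α hP)
  have hdeg := ((hα'.symm ▸ h).divMonomial_ne_zero_and_degree_eq hf hfQ hf0).2
  rw [hα', hdeg] at hleast
  rw [hα'] at hf
  have hmem := h.add_single_mem_of_isZariskiOpen hU hlead hα hf hfQ hf0
  have hle := le_of_add_le_add_left (hleast.2 ⟨hmem, (h.filter_add_single_eq _).symm ▸ h.notMem⟩)
  obtain ⟨e, he⟩ : ∃ e, (degRevLex n).degree (f.divMonomial s) = Finsupp.single p e := by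
    refine ⟨_, Finsupp.support_subset_singleton.1 ((Finsupp.support_mono hle).trans ?_)⟩
    exact Finsupp.support_single_subset
  rw [he] at hleast
  refine ⟨e, Nat.pos_of_ne_zero ?_, hleast⟩
  rintro rfl
  rw [Finsupp.single_zero, add_zero] at hleast
  exact h.notMem hleast.1.1

end ExtraGenerator

theorem theorem4p2_general {k : Type*} [Field k] [Infinite k] {n r : ℕ} (hrn : r < n)
    (P : Ideal (MvPolynomial (Fin n) k)) (hP : P.IsPrimary)
    (J : Ideal (MvPolynomial (Fin n) k)) (hJ : IsGenericInitialIdeal P J)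
    (u : MvPolynomial (Fin r) k) (a : Fin r →₀ ℕ) (hu : u = monomial a 1)
    (hcolon : u ∈ (J.map (projVars k n r)).colon (maxHomogeneousIdeal k r))
    (hnot : u ∉ J.map (projVars k n r))
    (hPhi : PhiBar r J = J.map (projVars k n r) ⊔ Ideal.span {u}) :
    ((u = 1 ∧ ∀ i : Fin n, i.val < r → X i ∈ J) ∨ ∃ b, IsExtraGenerator r J b) ∧
    (u ≠ 1 → ∀ b, IsExtraGenerator r J b →
      ∃ e : ℕ, 0 < e ∧ monomial b 1 = rename (Fin.castLE hrn.le) u * X ⟨r, hrn⟩ ^ e) ∧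
    (u ≠ 1 → ∃ B : Set (Fin n →₀ ℕ), (∀ b ∈ B, ∀ j : Fin n, r < j.val → b j = 0) ∧
      J = Ideal.span ((fun b => monomial b 1) '' B)) := by
  subst hu
  have hJmon := hJ.isMonomialIdeal
  have h := isSocleShape_exponents hrn.le hJmon hcolon hnot hPhi
  rcases eq_or_ne a 0 with rfl | ha
  · refine ⟨Or.inl ⟨rfl, fun i hi => ?_⟩, fun hu => absurd rfl hu, fun hu => absurd rfl hu⟩
    rw [X, ← zero_add (Finsupp.single i 1), ← Finsupp.mapDomain_zero (f := Fin.castLE hrn.le)]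
    exact h.add_single_mem i hi
  have hs : a.mapDomain (Fin.castLE hrn.le) ≠ 0 :=
    (map_ne_zero_iff (Finsupp.mapDomain.addMonoidHom (Fin.castLE hrn.le))
      (Finsupp.mapDomain_injective (Fin.castLE_injective hrn.le))).2 ha
  obtain ⟨e, he, hleast⟩ := h.exists_isLeast_add_single (p := ⟨r, hrn⟩) hs hP hJ
  refine ⟨Or.inr ⟨_, (isExtraGenerator_iff hJmon).2 hleast⟩, fun _ b hb => ⟨e, he, ?_⟩,
    fun _ => exists_eq_span_of_isLeast hJmon (fun j hj => ?_) hleast⟩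
  · rw [((isExtraGenerator_iff hJmon).1 hb).unique hleast, rename_monomial, X_pow_eq_monomial,
      monomial_mul, one_mul]
  · rw [Finsupp.add_apply, Finsupp.single_eq_of_ne (Fin.lt_def.2 hj).ne', add_zero]
    exact not_imp_comm.1 ((Finsupp.filter_eq_self_iff _ _).1 h.filter_eq j) hj.not_gt

/-- Variables are indexed from `0`, so `x_i` is `X (i - 1)`; in particular `x_{r+1}` is
`X ⟨r, hrn⟩`, and `u` is the monomial of `k[x₁,…,x_r]` with exponent vector `a`. -/
theorem theorem4p2 {k : Type*} [Field k] [Infinite k] {n r : ℕ} (hr : 1 ≤ r) (hrn : r < n)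
    (P : Ideal (MvPolynomial (Fin n) k)) (hP : P.IsPrime)
    (hhom : P.IsHomogeneous (homogeneousSubmodule (Fin n) k))
    (J : Ideal (MvPolynomial (Fin n) k)) (hJ : IsGenericInitialIdeal P J)
    (u : MvPolynomial (Fin r) k) (a : Fin r →₀ ℕ) (hu : u = monomial a 1)
    (hcolon : u ∈ (J.map (projVars k n r)).colon (maxHomogeneousIdeal k r))
    (hnot : u ∉ J.map (projVars k n r))
    (hPhi : PhiBar r J = J.map (projVars k n r) ⊔ Ideal.span {u}) :
    ((u = 1 ∧ ∀ i : Fin n, i.val < r → X i ∈ J) ∨ ∃ b, IsExtraGenerator r J b) ∧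
    (u ≠ 1 → ∀ b, IsExtraGenerator r J b →
      ∃ e : ℕ, 0 < e ∧ monomial b 1 = rename (Fin.castLE hrn.le) u * X ⟨r, hrn⟩ ^ e) ∧
    (u ≠ 1 → ∃ B : Set (Fin n →₀ ℕ), (∀ b ∈ B, ∀ j : Fin n, r < j.val → b j = 0) ∧
      J = Ideal.span ((fun b => monomial b 1) '' B)) :=
  theorem4p2_general hrn P hP.isPrimary J hJ u a hu hcolon hnot hPhi
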